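/- Let $S$ be a semifield, i.e. a commutative semiring with $1\neq 0$ in which every nonzero element has a multiplicative inverse. Let $\mathcal G$ be a nonempty ample groupoid, i.e. a topological groupoid (not necessarily Hausdorff) whose unit space $\mathcal G^{(0)}$ is locally compact, Hausdorff and totally disconnected, and whose source and range maps $s,r\colon\mathcal G\to\mathcal G^{(0)}$ are local homeomorphisms. A bisection is a subset $U\subseteq\mathcal G$ such that $s|_U$ and $r|_U$ are homeomorphisms onto their images. The Steinberg algebra $A_S(\mathcal G)$ is the $S$-submodule of $S^{\mathcal G}$ spanned by the characteristic functions $1_U$ of the compact open bisections $U$ of $\mathcal G$, with the convolution product $$(f*g)(\gamma)=\sum_{\alpha\beta=\gamma} f(\alpha)\,g(\beta).$$ Suppose that $A_S(\mathcal G)$ is congruence-simple, i.e. the only equivalence relations on $A_S(\mathcal G)$ that are compatible with addition and multiplication are the diagonal and the full relation. Then: 1. $S$ is either a field or (isomorphic to) the Boolean semifield $\mathbb B=(\{0,1\},\mathrm{or},\mathrm{and})$; 2. $\mathcal G$ is minimal, i.e. every open set $D\subseteq\mathcal G^{(0)}$ that is invariant ($s(\gamma)\in D$ implies $r(\gamma)\in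 D$ for all $\gamma\in\mathcal G$) is $\varnothing$ or $\mathcal G^{(0)}$; and $\mathcal G$ is effective, i.e. the interior of $\{\gamma\in\mathcal G\mid s(\gamma)=r(\gamma)\}$ in $\mathcal G$ equals $\mathcal G^{(0)}$. -/

import Mathlib

namespace Steinberg

open CategoryTheory Topology

universe v u w

/-- The set of all morphisms of a (small) groupoid with object set `X`. -/
@[ext]
structure Arr (X : Type u) [Groupoid.{v} X] where
  /-- source -/
  src : X
  /-- range -/
  tgt : X
  /-- the morphism -/
  hom : src ⟶ tgt

namespace Arr

variable {X : Type u} [Groupoid.{v} X]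

/-- The identity morphism of an object. -/
def unit (x : X) : Arr X := ⟨x, x, 𝟙 x⟩

/-- The inverse morphism. -/
def inv (α : Arr X) : Arr X := ⟨α.tgt, α.src, Groupoid.inv α.hom⟩

/-- The product `αβ` (first `β`, then `α`), defined if the source of `α` is the range of `β`. -/
def comp (α β : Arr X) (h : α.src = β.tgt) : Arr X :=
  ⟨β.src, α.tgt, β.hom ≫ eqToHom h.symm ≫ α.hom⟩

@[simp] lemma src_unit (x : X) : (unit x).src = x := rfl
@[simp] lemma tgt_unit (x : X) : (unit x).tgt = x := rfl
@[simp] lemma src_inv (α : Arr X) : α.inv.src = α.tgt := rfl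
@[simp] lemma tgt_inv (α : Arr X) : α.inv.tgt = α.src := rfl
@[simp] lemma src_comp (α β : Arr X) (h : α.src = β.tgt) : (comp α β h).src = β.src := rfl
@[simp] lemma tgt_comp (α β : Arr X) (h : α.src = β.tgt) : (comp α β h).tgt = α.tgt := rfl

lemma comp_assoc (α β γ : Arr X) (h : α.src = β.tgt) (h' : β.src = γ.tgt) :
    comp (comp α β h) γ h' = comp α (comp β γ h') h := by
  obtain ⟨a, b, f⟩ := α
  obtain ⟨c, d, g⟩ := β
  obtain ⟨i, j, k⟩ := γ
  dsimp only at h h'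
  subst h
  subst h'
  change Arr.mk i b (k ≫ 𝟙 c ≫ g ≫ 𝟙 a ≫ f) = Arr.mk i b ((k ≫ 𝟙 c ≫ g) ≫ 𝟙 a ≫ f)
  simp

lemma inv_comp_cancel (α β : Arr X) (h : α.src = β.tgt) :
    comp α.inv (comp α β h) rfl = β := by
  obtain ⟨a, b, f⟩ := α
  obtain ⟨c, d, g⟩ := β
  dsimp only at h
  subst h
  simp [comp, inv]

lemma comp_inv_cancel (α γ : Arr X) (h : α.tgt = γ.tgt) :
    comp α (comp α.inv γ h) rfl = γ := by
  obtain ⟨a, b, f⟩ := α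
  obtain ⟨c, d, g⟩ := γ
  dsimp only at h
  subst h
  simp [comp, inv]

end Arr

open Arr

/-- A topological groupoid.  The topology of the object set `X` is that of the subspace of units:
`Arr.unit` is continuous with continuous left inverse `Arr.src`, hence an embedding. -/
class TopologicalGroupoid (X : Type u) [Groupoid.{v} X] [TopologicalSpace X]
    [TopologicalSpace (Arr X)] : Prop where
  continuous_unit : Continuous (Arr.unit : X → Arr X)
  continuous_src : Continuous (Arr.src : Arr X → X)
  continuous_tgt : Continuous (Arr.tgt : Arr X → X)
  continuous_inv : Continuous (Arr.inv : Arr X → Arr X)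
  continuous_comp :
    Continuous fun p : {p : Arr X × Arr X // p.1.src = p.2.tgt} => comp p.1.1 p.1.2 p.2

/-- An étale groupoid: the unit space is locally compact Hausdorff, and source and range are local
homeomorphisms. -/
class EtaleGroupoid (X : Type u) [Groupoid.{v} X] [TopologicalSpace X]
    [TopologicalSpace (Arr X)] : Prop extends TopologicalGroupoid X where
  locallyCompactSpace : LocallyCompactSpace X
  t2Space : T2Space X
  isLocalHomeomorph_src : IsLocalHomeomorph (Arr.src : Arr X → X)
  isLocalHomeomorph_tgt : IsLocalHomeomorph (Arr.tgt : Arr X → X)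

/-- An ample groupoid: an étale groupoid with totally disconnected unit space. -/
class AmpleGroupoid (X : Type u) [Groupoid.{v} X] [TopologicalSpace X]
    [TopologicalSpace (Arr X)] : Prop extends EtaleGroupoid X where
  totallyDisconnectedSpace : TotallyDisconnectedSpace X

section Notions

variable (X : Type u) [Groupoid.{v} X]

/-- The isotropy subgroupoid. -/
def iso : Set (Arr X) := {γ | γ.src = γ.tgt}

variable {X} in
/-- Invariant sets of units. -/
def IsInvariant (D : Set X) : Prop := ∀ γ : Arr X, γ.src ∈ D → γ.tgt ∈ D

/-- There are no nontrivial open invariant sets of units. -/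
def IsMinimalGroupoid [TopologicalSpace X] : Prop :=
  ∀ D : Set X, IsOpen D → IsInvariant D → D = ∅ ∨ D = Set.univ

/-- The interior of the isotropy subgroupoid is the set of units. -/
def IsEffectiveGroupoid [TopologicalSpace (Arr X)] : Prop :=
  interior (iso X) = Set.range (Arr.unit : X → Arr X)

variable {X}

/-- A bisection: source and range restrict to homeomorphisms onto their images. -/
def IsBisection [TopologicalSpace X] [TopologicalSpace (Arr X)] (U : Set (Arr X)) : Prop :=
  IsEmbedding (U.domRestrict Arr.src) ∧ IsEmbedding (U.domRestrict Arr.tgt)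

/-- Compact open bisections. -/
structure IsCompactOpenBisection [TopologicalSpace X] [TopologicalSpace (Arr X)]
    (U : Set (Arr X)) : Prop where
  isCompact : IsCompact U
  isOpen : IsOpen U
  isBisection : IsBisection U

/-- The factorizations `γ = αβ`. -/
def factorizations (γ : Arr X) : Set (Arr X × Arr X) :=
  {p | ∃ h : p.1.src = p.2.tgt, comp p.1 p.2 h = γ}

/-- The convolution `(f * g)(γ) = ∑_{αβ = γ} f(α) g(β)`. -/
noncomputable def conv {S : Type w} [CommSemiring S] (f g : Arr X → S) : Arr X → S :=
  fun γ => ∑ᶠ p : factorizations γ, f p.1.1 * g p.1.2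

/-- The characteristic function of a set. -/
noncomputable def chi (S : Type w) [CommSemiring S] (U : Set (Arr X)) : Arr X → S :=
  U.indicator 1

/-- The product `UV` of sets of morphisms. -/
def setMul (U V : Set (Arr X)) : Set (Arr X) :=
  {γ | ∃ α ∈ U, ∃ β ∈ V, ∃ h : α.src = β.tgt, comp α β h = γ}

end Notions

/-- The Steinberg algebra `A_S(G)` as a submodule of the module of functions `G → S`. -/
def steinbergAlgebra (S : Type w) (X : Type u) [CommSemiring S] [Groupoid.{v} X]
    [TopologicalSpace X] [TopologicalSpace (Arr X)] : Submodule S (Arr X → S) :=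
  Submodule.span S {f | ∃ U : Set (Arr X), IsCompactOpenBisection U ∧ f = chi S U}

section Algebra

variable {S : Type w} {X : Type u} [CommSemiring S] [Groupoid.{v} X]

lemma factorizations_fst_injective (γ : Arr X) :
    Function.Injective fun p : factorizations γ => p.1.1 := by
  rintro ⟨⟨α, β⟩, h, rfl⟩ ⟨⟨α', β'⟩, h', e⟩ hα
  dsimp only at hα
  subst hα
  have := inv_comp_cancel α β h
  dsimp only at e h h'
  have e2 : β' = β := by
    rw [← inv_comp_cancel α β' h', ← inv_comp_cancel α β h]
    congr 1
  subst e2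
  rfl

lemma zero_conv (g : Arr X → S) : conv 0 g = 0 := by
  funext γ
  simp [conv]

lemma conv_zero (f : Arr X → S) : conv f 0 = 0 := by
  funext γ
  simp [conv]

lemma setMul_assoc (U V W : Set (Arr X)) :
    setMul (setMul U V) W = setMul U (setMul V W) := by
  ext γ
  constructor
  · rintro ⟨_, ⟨α, hα, β, hβ, h, rfl⟩, δ, hδ, h', rfl⟩
    exact ⟨α, hα, comp β δ h', ⟨β, hβ, δ, hδ, h', rfl⟩, h, (comp_assoc α β δ h h').symm⟩
  · rintro ⟨α, hα, _, ⟨β, hβ, δ, hδ, h', rfl⟩, h, rfl⟩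
    exact ⟨comp α β h, ⟨α, hα, β, hβ, h, rfl⟩, δ, hδ, h', comp_assoc α β δ h h'⟩

variable [TopologicalSpace X] [TopologicalSpace (Arr X)]

lemma IsBisection.injOn_src {U : Set (Arr X)} (hU : IsBisection U) : Set.InjOn Arr.src U :=
  Set.injOn_iff_injective.2 hU.1.injective

lemma IsBisection.injOn_tgt {U : Set (Arr X)} (hU : IsBisection U) : Set.InjOn Arr.tgt U :=
  Set.injOn_iff_injective.2 hU.2.injective

lemma isBisection_of_injOn [EtaleGroupoid X] {U : Set (Arr X)} (hU : IsOpen U)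
    (h₁ : Set.InjOn Arr.src U) (h₂ : Set.InjOn Arr.tgt U) : IsBisection U := by
  have key : ∀ φ : Arr X → X, IsLocalHomeomorph φ → Set.InjOn φ U →
      IsEmbedding (U.domRestrict φ) := fun φ hφ hi =>
    (IsOpenEmbedding.of_continuous_injective_isOpenMap
      (hφ.continuous.comp continuous_subtype_val) (Set.injOn_iff_injective.1 hi)
      (hφ.isOpenMap.comp hU.isOpenMap_subtype_val)).isEmbedding
  exact ⟨key _ EtaleGroupoid.isLocalHomeomorph_src h₁,
    key _ EtaleGroupoid.isLocalHomeomorph_tgt h₂⟩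

lemma isOpen_setMul [EtaleGroupoid X] {U V : Set (Arr X)} (hU : IsOpen U) (hV : IsOpen V) :
    IsOpen (setMul U V) := by
  -- the continuous map `(α, γ) ↦ α⁻¹γ`
  let m : {p : Arr X × Arr X // p.1.tgt = p.2.tgt} → Arr X := fun p => comp p.1.1.inv p.1.2 p.2
  have hm : Continuous m :=
    (TopologicalGroupoid.continuous_comp (X := X)).comp
      (Continuous.subtype_mk (f := fun p : {p : Arr X × Arr X // p.1.tgt = p.2.tgt} =>
          (p.1.1.inv, p.1.2))
        (((TopologicalGroupoid.continuous_inv (X := X)).comp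
          (continuous_fst.comp continuous_subtype_val)).prodMk
            (continuous_snd.comp continuous_subtype_val)) fun p => p.2)
  obtain ⟨W, hW, hWm⟩ := isOpen_induced_iff.1 (hV.preimage hm)
  rw [isOpen_iff_mem_nhds]
  rintro _ ⟨α, hα, β, hβ, h, rfl⟩
  have hmem : (⟨(α, comp α β h), rfl⟩ : {p : Arr X × Arr X // p.1.tgt = p.2.tgt}) ∈ m ⁻¹' V := by
    change comp α.inv (comp α β h) rfl ∈ V
    rwa [inv_comp_cancel]
  rw [← hWm] at hmem
  obtain ⟨A, C, hA, hC, hαA, hγC, hAC⟩ := isOpen_prod_iff.1 hW _ _ hmem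
  have hT : IsOpen (Arr.tgt '' (A ∩ U)) :=
    (EtaleGroupoid.isLocalHomeomorph_tgt (X := X)).isOpenMap _ (hA.inter hU)
  refine Filter.mem_of_superset ((hC.inter (hT.preimage
    (TopologicalGroupoid.continuous_tgt (X := X)))).mem_nhds ⟨hγC, α, ⟨hαA, hα⟩, rfl⟩) ?_
  rintro γ ⟨hγ, α', ⟨hα'A, hα'⟩, e⟩
  have : (⟨(α', γ), e⟩ : {p : Arr X × Arr X // p.1.tgt = p.2.tgt}) ∈ m ⁻¹' V := by
    rw [← hWm]
    exact hAC ⟨hα'A, hγ⟩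
  exact ⟨α', hα', _, this, rfl, comp_inv_cancel α' γ e⟩

lemma isCompact_setMul [EtaleGroupoid X] {U V : Set (Arr X)} (hU : IsCompact U)
    (hV : IsCompact V) : IsCompact (setMul U V) := by
  have : T2Space X := EtaleGroupoid.t2Space
  have hclosed : IsClosed {p : Arr X × Arr X | p.1.src = p.2.tgt} :=
    isClosed_eq ((TopologicalGroupoid.continuous_src (X := X)).comp continuous_fst)
      ((TopologicalGroupoid.continuous_tgt (X := X)).comp continuous_snd)
  have hK := (hclosed.isClosedEmbedding_subtypeVal.isCompact_preimage (hU.prod hV)).image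
    (TopologicalGroupoid.continuous_comp (X := X))
  convert hK using 1
  ext γ
  constructor
  · rintro ⟨α, hα, β, hβ, h, rfl⟩
    exact ⟨⟨(α, β), h⟩, ⟨hα, hβ⟩, rfl⟩
  · rintro ⟨⟨⟨α, β⟩, h⟩, ⟨hα, hβ⟩, rfl⟩
    exact ⟨α, hα, β, hβ, h, rfl⟩

lemma IsCompactOpenBisection.setMul [EtaleGroupoid X] {U V : Set (Arr X)}
    (hU : IsCompactOpenBisection U) (hV : IsCompactOpenBisection V) :
    IsCompactOpenBisection (setMul U V) := by
  have ho := isOpen_setMul hU.isOpen hV.isOpen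
  refine ⟨isCompact_setMul hU.isCompact hV.isCompact, ho, isBisection_of_injOn ho ?_ ?_⟩
  · rintro _ ⟨α, hα, β, hβ, h, rfl⟩ _ ⟨α', hα', β', hβ', h', rfl⟩ e
    obtain rfl := hV.isBisection.injOn_src hβ hβ' e
    obtain rfl := hU.isBisection.injOn_src hα hα' (h.trans h'.symm)
    rfl
  · rintro _ ⟨α, hα, β, hβ, h, rfl⟩ _ ⟨α', hα', β', hβ', h', rfl⟩ e
    obtain rfl := hU.isBisection.injOn_tgt hα hα' e
    obtain rfl := hV.isBisection.injOn_tgt hβ hβ' (h.symm.trans h')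
    rfl

lemma chi_mem {U : Set (Arr X)} (hU : IsCompactOpenBisection U) :
    chi S U ∈ steinbergAlgebra S X :=
  Submodule.subset_span ⟨U, hU, rfl⟩

lemma finite_support_tgt {f : Arr X → S} (hf : f ∈ steinbergAlgebra S X) (y : X) :
    {α | f α ≠ 0 ∧ α.tgt = y}.Finite := by
  induction hf using Submodule.span_induction with
  | mem f hf =>
    obtain ⟨U, hU, rfl⟩ := hf
    refine Set.Subsingleton.finite ?_
    rintro α ⟨hα, hαy⟩ β ⟨hβ, hβy⟩
    exact hU.isBisection.injOn_tgt (Set.mem_of_indicator_ne_zero hα)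
      (Set.mem_of_indicator_ne_zero hβ) (hαy.trans hβy.symm)
  | zero => simp
  | add f g _ _ hf hg =>
    refine (hf.union hg).subset ?_
    rintro α ⟨hα, hy⟩
    by_cases h : f α = 0
    · exact Or.inr ⟨fun h' => hα (by simp [h, h']), hy⟩
    · exact Or.inl ⟨h, hy⟩
  | smul a f _ hf =>
    refine hf.subset ?_
    rintro α ⟨hα, hy⟩
    exact ⟨fun h' => hα (by simp [h']), hy⟩

lemma finite_support_conv {f : Arr X → S} (hf : f ∈ steinbergAlgebra S X) (g : Arr X → S)
    (γ : Arr X) :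
    (Function.support fun p : factorizations γ => f p.1.1 * g p.1.2).Finite := by
  refine Set.Finite.of_finite_image (f := fun p : factorizations γ => p.1.1)
    ((finite_support_tgt hf γ.tgt).subset ?_) (factorizations_fst_injective γ).injOn
  rintro _ ⟨⟨⟨α, β⟩, h, rfl⟩, hp, rfl⟩
  exact ⟨left_ne_zero_of_mul hp, rfl⟩

lemma add_conv {f f' : Arr X → S} (hf : f ∈ steinbergAlgebra S X)
    (hf' : f' ∈ steinbergAlgebra S X) (g : Arr X → S) :
    conv (f + f') g = conv f g + conv f' g := by
  funext γ
  simp only [conv, Pi.add_apply, add_mul]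
  exact finsum_add_distrib (finite_support_conv hf g γ) (finite_support_conv hf' g γ)

lemma conv_add {f : Arr X → S} (hf : f ∈ steinbergAlgebra S X) (g g' : Arr X → S) :
    conv f (g + g') = conv f g + conv f g' := by
  funext γ
  simp only [conv, Pi.add_apply, mul_add]
  exact finsum_add_distrib (finite_support_conv hf g γ) (finite_support_conv hf g' γ)

lemma smul_conv (a : S) {f : Arr X → S} (hf : f ∈ steinbergAlgebra S X) (g : Arr X → S) :
    conv (a • f) g = a • conv f g := by
  funext γ
  simp only [conv, Pi.smul_apply, smul_eq_mul, mul_assoc]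
  exact (mul_finsum' _ a (finite_support_conv hf g γ)).symm

lemma conv_smul (a : S) {f : Arr X → S} (hf : f ∈ steinbergAlgebra S X) (g : Arr X → S) :
    conv f (a • g) = a • conv f g := by
  funext γ
  simp only [conv, Pi.smul_apply, smul_eq_mul, mul_left_comm _ a]
  exact (mul_finsum' _ a (finite_support_conv hf g γ)).symm

lemma chi_conv_chi {U V : Set (Arr X)} (hU : IsBisection U) :
    conv (chi S U) (chi S V) = chi S (setMul U V) := by
  classical
  funext γ
  by_cases hγ : γ ∈ setMul U V
  · obtain ⟨α, hα, β, hβ, h, rfl⟩ := hγ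
    rw [conv, finsum_eq_single _ (⟨(α, β), h, rfl⟩ : factorizations (comp α β h))]
    · have : comp α β h ∈ setMul U V := ⟨α, hα, β, hβ, h, rfl⟩
      simp [chi, hα, hβ, this]
    · intro p hp
      by_contra hne
      refine hp (factorizations_fst_injective _ ?_)
      have h1 : p.1.1 ∈ U := Set.mem_of_indicator_ne_zero (left_ne_zero_of_mul hne)
      obtain ⟨⟨α', β'⟩, h', e⟩ := p
      have e' := congrArg Arr.tgt e
      exact hU.injOn_tgt h1 hα e'
  · rw [conv, show chi S (setMul U V) γ = 0 from Set.indicator_of_notMem hγ _]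
    refine (finsum_congr fun p => ?_).trans finsum_zero
    by_contra hne
    obtain ⟨⟨α, β⟩, h, e⟩ := p
    exact hγ ⟨α, Set.mem_of_indicator_ne_zero (left_ne_zero_of_mul hne), β,
      Set.mem_of_indicator_ne_zero (right_ne_zero_of_mul hne), h, e⟩

lemma conv_mem [EtaleGroupoid X] {f g : Arr X → S} (hf : f ∈ steinbergAlgebra S X)
    (hg : g ∈ steinbergAlgebra S X) : conv f g ∈ steinbergAlgebra S X := by
  induction hf using Submodule.span_induction with
  | mem f hf =>
    obtain ⟨U, hU, rfl⟩ := hf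
    induction hg using Submodule.span_induction with
    | mem g hg =>
      obtain ⟨V, hV, rfl⟩ := hg
      rw [chi_conv_chi hU.isBisection]
      exact chi_mem (hU.setMul hV)
    | zero => rw [conv_zero]; exact zero_mem _
    | add g g' _ _ hg hg' => rw [conv_add (chi_mem hU)]; exact add_mem hg hg'
    | smul a g _ hg => rw [conv_smul a (chi_mem hU)]; exact Submodule.smul_mem _ a hg
  | zero => rw [zero_conv]; exact zero_mem _
  | add f f' hfm hfm' hf hf' => rw [add_conv hfm hfm']; exact add_mem hf hf'
  | smul a f hfm hf => rw [smul_conv a hfm]; exact Submodule.smul_mem _ a hf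

lemma conv_assoc [EtaleGroupoid X] {f g k : Arr X → S} (hf : f ∈ steinbergAlgebra S X)
    (hg : g ∈ steinbergAlgebra S X) (hk : k ∈ steinbergAlgebra S X) :
    conv (conv f g) k = conv f (conv g k) := by
  induction hf using Submodule.span_induction with
  | mem f hf =>
    obtain ⟨U, hU, rfl⟩ := hf
    induction hg using Submodule.span_induction with
    | mem g hg =>
      obtain ⟨V, hV, rfl⟩ := hg
      have hUV : chi S (setMul U V) ∈ steinbergAlgebra S X := chi_mem (hU.setMul hV)
      rw [chi_conv_chi hU.isBisection]
      induction hk using Submodule.span_induction with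
      | mem k hk =>
        obtain ⟨W, hW, rfl⟩ := hk
        rw [chi_conv_chi (hU.setMul hV).isBisection, chi_conv_chi hV.isBisection,
          chi_conv_chi hU.isBisection, setMul_assoc]
      | zero => simp only [conv_zero]
      | add k k' _ _ hk hk' =>
        rw [conv_add hUV, conv_add (chi_mem hV), conv_add (chi_mem hU), hk, hk']
      | smul a k _ hk =>
        rw [conv_smul a hUV, conv_smul a (chi_mem hV), conv_smul a (chi_mem hU), hk]
    | zero => simp only [conv_zero, zero_conv]
    | add g g' hgm hgm' hg hg' =>
      rw [conv_add (chi_mem hU), add_conv (conv_mem (chi_mem hU) hgm)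
        (conv_mem (chi_mem hU) hgm'), add_conv hgm hgm', conv_add (chi_mem hU), hg, hg']
    | smul a g hgm hg =>
      rw [conv_smul a (chi_mem hU), smul_conv a (conv_mem (chi_mem hU) hgm),
        smul_conv a hgm, conv_smul a (chi_mem hU), hg]
  | zero => simp only [zero_conv]
  | add f f' hfm hfm' hf hf' =>
    rw [add_conv hfm hfm', add_conv (conv_mem hfm hg) (conv_mem hfm' hg),
      add_conv hfm hfm', hf, hf']
  | smul a f hfm hf =>
    rw [smul_conv a hfm, smul_conv a (conv_mem hfm hg), smul_conv a hfm, hf]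

variable (S X) in
/-- The Steinberg algebra is a hemiring under pointwise addition and convolution. -/
noncomputable instance [EtaleGroupoid X] : NonUnitalSemiring (steinbergAlgebra S X) where
  __ := (inferInstance : AddCommMonoid (steinbergAlgebra S X))
  mul f g := ⟨conv f.1 g.1, conv_mem f.2 g.2⟩
  left_distrib f g k := Subtype.ext (conv_add f.2 g.1 k.1)
  right_distrib f g k := Subtype.ext (add_conv f.2 g.2 k.1)
  zero_mul f := Subtype.ext (zero_conv f.1)
  mul_zero f := Subtype.ext (conv_zero f.1)
  mul_assoc f g k := Subtype.ext (conv_assoc f.2 g.2 k.2)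

variable (S X) in
instance [EtaleGroupoid X] : IsScalarTower S (steinbergAlgebra S X) (steinbergAlgebra S X) where
  smul_assoc a f g := Subtype.ext (smul_conv a f.2 g.1)

variable (S X) in
instance [EtaleGroupoid X] : SMulCommClass S (steinbergAlgebra S X) (steinbergAlgebra S X) where
  smul_comm a f g := Subtype.ext (conv_smul a f.2 g.1).symm

end Algebra

/-- A hemiring is congruence-simple if its only congruences are the diagonal and the full one. -/
def IsCongruenceSimple (R : Type w) [NonUnitalSemiring R] : Prop :=
  ∀ c : RingCon R, (∀ x y, c x y → x = y) ∨ (∀ x y, c x y)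

/-- The underlying set `{0, 1}` of the Boolean semifield. -/
inductive BooleanSemifield : Type
  | zero
  | one

namespace BooleanSemifield

/-- Disjunction. -/
def or : BooleanSemifield → BooleanSemifield → BooleanSemifield
  | zero, b => b
  | one, _ => one

/-- Conjunction. -/
def and : BooleanSemifield → BooleanSemifield → BooleanSemifield
  | zero, _ => zero
  | one, b => b

instance : Zero BooleanSemifield := ⟨zero⟩
instance : One BooleanSemifield := ⟨one⟩
instance : Add BooleanSemifield := ⟨or⟩
instance : Mul BooleanSemifield := ⟨and⟩

instance : CommSemiring BooleanSemifield where
  add_assoc := by rintro (_ | _) (_ | _) (_ | _) <;> rfl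
  zero_add := by rintro (_ | _) <;> rfl
  add_zero := by rintro (_ | _) <;> rfl
  add_comm := by rintro (_ | _) (_ | _) <;> rfl
  mul_assoc := by rintro (_ | _) (_ | _) (_ | _) <;> rfl
  one_mul := by rintro (_ | _) <;> rfl
  mul_one := by rintro (_ | _) <;> rfl
  mul_comm := by rintro (_ | _) (_ | _) <;> rfl
  left_distrib := by rintro (_ | _) (_ | _) (_ | _) <;> rfl
  right_distrib := by rintro (_ | _) (_ | _) (_ | _) <;> rfl
  zero_mul := by rintro (_ | _) <;> rfl
  mul_zero := by rintro (_ | _) <;> rfl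
  nsmul := nsmulRec

end BooleanSemifield

end Steinberg

namespace Steinberg

open CategoryTheory Topology Arr

universe v u w

/-! ### Compact open bisections of an ample groupoid. -/

section Topological

variable {X : Type u} [Groupoid.{v} X] [TopologicalSpace X] [TopologicalSpace (Arr X)]

/-! Each conclusion comes from testing simplicity on one congruence, against the functions 1_K with
K a compact open set of units. Minimality (`reductionCon`): for D invariant, equality at arrows with
range outside D is a congruence. It identifies 1_K with 0 when K ⊆ D, and separates them when K
meets the complement of D. Effectiveness (`actionCon`): the algebra acts on functions on the unit
space, where a bisection U of isotropy acts like the units s(U). This action is nonzero, hence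
faithful by simplicity, so U consists of units. Coefficients (`supportCon`): if 1 has a negative, S
is a field. Otherwise S has no zero sums, so having equal supports is a congruence. It identifies
a·1_K with 1_K for every a ≠ 0, which forces a = 1; then 1 + 1 = 1 and S is Boolean. -/

lemma isOpenMap_unit [EtaleGroupoid X] : IsOpenMap (Arr.unit : X → Arr X) :=
  (IsLocalHomeomorph.of_comp (g := Arr.src) (f := Arr.unit)
    (Homeomorph.refl X).isLocalHomeomorph EtaleGroupoid.isLocalHomeomorph_src TopologicalGroupoid.continuous_unit).isOpenMap

lemma isCompactOpenBisection_image_unit [EtaleGroupoid X] {K : Set X} (hK : IsCompact K)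
    (hKo : IsOpen K) : IsCompactOpenBisection (Arr.unit '' K) := by
  have ho := isOpenMap_unit _ hKo
  refine ⟨hK.image TopologicalGroupoid.continuous_unit, ho, isBisection_of_injOn ho ?_ ?_⟩ <;>
  · rintro _ ⟨x, -, rfl⟩ _ ⟨y, -, rfl⟩ (rfl : x = y)
    rfl

/-- The compact open sets form a basis of the unit space of an ample groupoid. -/
lemma exists_isCompact_isOpen_subset [AmpleGroupoid X] {D : Set X} (hD : IsOpen D) {x : X}
    (hx : x ∈ D) : ∃ K : Set X, IsCompact K ∧ IsOpen K ∧ x ∈ K ∧ K ⊆ D := by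
  have : T2Space X := EtaleGroupoid.t2Space
  have : LocallyCompactSpace X := EtaleGroupoid.locallyCompactSpace
  have : TotallyDisconnectedSpace X := AmpleGroupoid.totallyDisconnectedSpace
  obtain ⟨C, hC, hxC, hCD⟩ := exists_compact_subset hD hx
  obtain ⟨K, hK, hxK, hKC⟩ := loc_compact_Haus_tot_disc_of_zero_dim.exists_subset_of_mem_open
    hxC isOpen_interior
  have hKC' : K ⊆ C := hKC.trans interior_subset
  exact ⟨K, hC.of_isClosed_subset hK.isClosed hKC', hK.isOpen, hxK, hKC'.trans hCD⟩

/-- A point in an open set of isotropy has compact open bisections as neighbourhoods. -/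
lemma exists_isCompactOpenBisection_subset_iso [AmpleGroupoid X] {W : Set (Arr X)}
    (hW : IsOpen W) (hWiso : W ⊆ iso X) {γ : Arr X} (hγ : γ ∈ W) :
    ∃ U : Set (Arr X), IsCompactOpenBisection U ∧ γ ∈ U ∧ U ⊆ W := by
  obtain ⟨e, he, hsrc⟩ := EtaleGroupoid.isLocalHomeomorph_src (X := X) γ
  obtain ⟨K, hK, hKo, hγK, hKe⟩ := exists_isCompact_isOpen_subset
    (e.isOpen_inter_preimage_symm hW) (x := e γ)
    ⟨e.map_source he, by simpa only [Set.mem_preimage, e.left_inv he] using hγ⟩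
  have hKt : K ⊆ e.target := fun x hx => (hKe hx).1
  have hUW : e.symm '' K ⊆ W := by
    rintro _ ⟨x, hx, rfl⟩
    exact (hKe hx).2
  have ho := e.isOpen_image_symm_of_subset_target hKo hKt
  have hinj : Set.InjOn Arr.src (e.symm '' K) := by
    rw [hsrc]
    exact e.injOn.mono (by rintro _ ⟨x, hx, rfl⟩; exact e.map_target (hKt hx))
  refine ⟨e.symm '' K, ⟨hK.image_of_continuousOn (e.continuousOn_symm.mono hKt), ho,
    isBisection_of_injOn ho hinj fun α hα β hβ h => hinj hα hβ ?_⟩,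
    ⟨e γ, hγK, e.left_inv he⟩, hUW⟩
  -- On isotropy range and source coincide, so one chart of the source map suffices.
  exact (hWiso (hUW hα)).trans (h.trans (hWiso (hUW hβ)).symm)

lemma range_unit_subset_interior_iso [EtaleGroupoid X] :
    Set.range (Arr.unit : X → Arr X) ⊆ interior (iso X) :=
  interior_maximal (by rintro _ ⟨x, rfl⟩; rfl) isOpenMap_unit.isOpen_range

end Topological

/-! ### The action of the Steinberg algebra on functions by convolution. -/

section Convolution

variable {S : Type w} {X : Type u} [CommSemiring S] [Groupoid.{v} X]

lemma chi_apply_of_mem {U : Set (Arr X)} {γ : Arr X} (h : γ ∈ U) : chi S U γ = 1 :=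
  Set.indicator_of_mem h _

lemma chi_apply_of_notMem {U : Set (Arr X)} {γ : Arr X} (h : γ ∉ U) : chi S U γ = 0 :=
  Set.indicator_of_notMem h _

lemma tgt_fst_of_factorization {γ : Arr X} (p : factorizations γ) : p.1.1.tgt = γ.tgt := by
  obtain ⟨⟨α, β⟩, h, rfl⟩ := p
  rfl

lemma exists_comp_eq_of_tgt_eq {α γ : Arr X} (h : α.tgt = γ.tgt) :
    ∃ (δ : Arr X) (h' : α.src = δ.tgt), comp α δ h' = γ :=
  ⟨comp α.inv γ h, rfl, comp_inv_cancel α γ h⟩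

/-- Only α in U has the right range, so a single factorization contributes: U acts by left
translation. -/
lemma chi_conv_comp {U : Set (Arr X)} (hU : Set.InjOn Arr.tgt U) (k : Arr X → S) {α δ : Arr X}
    (hα : α ∈ U) (h : α.src = δ.tgt) : conv (chi S U) k (comp α δ h) = k δ := by
  rw [conv, finsum_eq_single _ (⟨(α, δ), h, rfl⟩ : factorizations (comp α δ h))]
  · rw [chi_apply_of_mem hα, one_mul]
  · intro p hp
    by_contra hne
    refine hp (factorizations_fst_injective _ ?_)
    have h1 : p.1.1 ∈ U := Set.mem_of_indicator_ne_zero (left_ne_zero_of_mul hne)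
    exact hU h1 hα (tgt_fst_of_factorization p)

lemma chi_conv_of_forall_tgt_ne {U : Set (Arr X)} (k : Arr X → S) {γ : Arr X}
    (h : ∀ α ∈ U, α.tgt ≠ γ.tgt) : conv (chi S U) k γ = 0 := by
  refine (finsum_congr fun p => ?_).trans finsum_zero
  rw [chi_apply_of_notMem fun hα => h _ hα (tgt_fst_of_factorization p), zero_mul]

/-- A function φ on the unit space is encoded as `φ ∘ Arr.tgt`; on such functions U acts by the
partial bijection from ranges to sources. -/
lemma chi_conv_comp_tgt {U : Set (Arr X)} (hU : Set.InjOn Arr.tgt U)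
    (φ : X → S) {α γ : Arr X} (hα : α ∈ U) (h : α.tgt = γ.tgt) :
    conv (chi S U) (φ ∘ Arr.tgt) γ = φ α.src := by
  obtain ⟨δ, h', rfl⟩ := exists_comp_eq_of_tgt_eq h
  rw [chi_conv_comp hU _ hα, h', Function.comp_apply]

lemma chi_image_unit_conv_comp_tgt {K : Set X} (φ : X → S) {γ : Arr X}
    (h : γ.tgt ∈ K) : conv (chi S (unit '' K)) (φ ∘ Arr.tgt) γ = φ γ.tgt := by
  refine chi_conv_comp_tgt ?_ φ (Set.mem_image_of_mem unit h) rfl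
  rintro _ ⟨x, -, rfl⟩ _ ⟨y, -, rfl⟩ (rfl : x = y)
  rfl

/-- Convolution with a function of the range is again a function of the range. -/
lemma exists_conv_comp_tgt (f : Arr X → S) (φ : X → S) :
    ∃ ψ : X → S, conv f (φ ∘ Arr.tgt) = ψ ∘ Arr.tgt := by
  refine ⟨fun y => conv f (φ ∘ Arr.tgt) (unit y), funext fun γ => ?_⟩
  -- Replacing (α, β) by (α, α⁻¹) keeps the summand, since φ only sees the range of β, which is the
  -- source of α.
  refine finsum_eq_of_bijective (fun p => ⟨(p.1.1, p.1.1.inv), rfl, ?_⟩) ⟨?_, ?_⟩ ?_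
  · obtain ⟨⟨α, β⟩, h, rfl⟩ := p
    simp [comp, Arr.inv, unit]
  · intro p q hpq
    exact factorizations_fst_injective γ (congrArg (fun r => r.1.1) hpq)
  · rintro ⟨⟨α, β⟩, h, e⟩
    obtain ⟨δ, hδ, e'⟩ := exists_comp_eq_of_tgt_eq (α := α) (γ := γ)
      (tgt_fst_of_factorization ⟨(α, β), h, e⟩)
    refine ⟨⟨(α, δ), hδ, e'⟩, ?_⟩
    exact factorizations_fst_injective _ rfl
  · rintro ⟨⟨α, β⟩, h, e⟩
    simp only [Function.comp_apply, tgt_inv]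
    rw [show α.src = β.tgt from h]

variable [TopologicalSpace X] [TopologicalSpace (Arr X)]

/-- Both sides strip off the unique initial factors from U and V, and vanish if there are none. -/
lemma chi_setMul_conv [EtaleGroupoid X] {U V : Set (Arr X)} (hU : IsCompactOpenBisection U)
    (hV : IsCompactOpenBisection V) (k : Arr X → S) :
    conv (chi S (setMul U V)) k = conv (chi S U) (conv (chi S V) k) := by
  have hUV := (hU.setMul hV).isBisection.injOn_tgt
  funext γ
  by_cases hγ : ∃ α ∈ U, α.tgt = γ.tgt
  · obtain ⟨α, hα, ht⟩ := hγ
    obtain ⟨δ, h, rfl⟩ := exists_comp_eq_of_tgt_eq ht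
    rw [chi_conv_comp hU.isBisection.injOn_tgt _ hα]
    by_cases hδ : ∃ β ∈ V, β.tgt = δ.tgt
    · obtain ⟨β, hβ, ht'⟩ := hδ
      obtain ⟨ε, h', rfl⟩ := exists_comp_eq_of_tgt_eq ht'
      rw [chi_conv_comp hV.isBisection.injOn_tgt _ hβ, ← comp_assoc α β ε h h']
      exact chi_conv_comp hUV k ⟨α, hα, β, hβ, h, rfl⟩ h'
    · push Not at hδ
      rw [chi_conv_of_forall_tgt_ne _ hδ, chi_conv_of_forall_tgt_ne]
      rintro _ ⟨α', hα', β, hβ, h', rfl⟩ e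
      obtain rfl := hU.isBisection.injOn_tgt hα' hα e
      exact hδ β hβ (h'.symm.trans h)
  · push Not at hγ
    rw [chi_conv_of_forall_tgt_ne _ hγ, chi_conv_of_forall_tgt_ne]
    rintro _ ⟨α, hα, β, hβ, h, rfl⟩
    exact hγ α hα

/-- The Steinberg algebra acts on arbitrary functions by convolution. -/
lemma conv_conv [EtaleGroupoid X] {f g : Arr X → S} (hf : f ∈ steinbergAlgebra S X)
    (hg : g ∈ steinbergAlgebra S X) (k : Arr X → S) :
    conv (conv f g) k = conv f (conv g k) := by
  -- Only f and g are reduced to generators: k stays arbitrary because `φ ∘ Arr.tgt` need not lie in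
  -- the algebra.
  induction hf using Submodule.span_induction with
  | mem f hf =>
    obtain ⟨U, hU, rfl⟩ := hf
    induction hg using Submodule.span_induction with
    | mem g hg =>
      obtain ⟨V, hV, rfl⟩ := hg
      rw [chi_conv_chi hU.isBisection, chi_setMul_conv hU hV]
    | zero => simp only [conv_zero, zero_conv]
    | add g g' hgm hgm' hg hg' =>
      rw [conv_add (chi_mem hU), add_conv (conv_mem (chi_mem hU) hgm)
        (conv_mem (chi_mem hU) hgm'), add_conv hgm hgm', conv_add (chi_mem hU), hg, hg']
    | smul a g hgm hg =>
      rw [conv_smul a (chi_mem hU), smul_conv a (conv_mem (chi_mem hU) hgm),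
        smul_conv a hgm, conv_smul a (chi_mem hU), hg]
  | zero => simp only [zero_conv]
  | add f f' hfm hfm' hf hf' =>
    rw [add_conv hfm hfm', add_conv (conv_mem hfm hg) (conv_mem hfm' hg),
      add_conv hfm hfm', hf, hf']
  | smul a f hfm hf =>
    rw [smul_conv a hfm, smul_conv a (conv_mem hfm hg), smul_conv a hfm, hf]

end Convolution

/-! ### The three congruences. -/

section Congruences

variable {S : Type w} {X : Type u} [CommSemiring S] [Groupoid.{v} X]
  [TopologicalSpace X] [TopologicalSpace (Arr X)]

variable (S X) in
/-- Two elements are congruent if they act in the same way on functions on the unit space. -/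
def actionCon [EtaleGroupoid X] : RingCon (steinbergAlgebra S X) where
  r f g := ∀ φ : X → S, conv f.1 (φ ∘ Arr.tgt) = conv g.1 (φ ∘ Arr.tgt)
  iseqv := ⟨fun _ _ => rfl, fun h φ => (h φ).symm, fun h h' φ => (h φ).trans (h' φ)⟩
  add' {f f' g g'} h h' φ := by
    change conv (f.1 + g.1) _ = conv (f'.1 + g'.1) _
    rw [add_conv f.2 g.2, add_conv f'.2 g'.2, h φ, h' φ]
  mul' {f f' g g'} h h' φ := by
    change conv (conv f.1 g.1) _ = conv (conv f'.1 g'.1) _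
    rw [conv_conv f.2 g.2, conv_conv f'.2 g'.2, h' φ]
    -- The hypothesis on f and f' applies because g' maps functions of the range to functions of the
    -- range.
    obtain ⟨ψ, hψ⟩ := exists_conv_comp_tgt g'.1 φ
    rw [hψ, h ψ]

variable (S) in
/-- Two elements are congruent if they agree outside of the reduction to an invariant set. -/
def reductionCon [EtaleGroupoid X] {D : Set X} (hD : IsInvariant D) :
    RingCon (steinbergAlgebra S X) where
  r f g := ∀ γ : Arr X, γ.tgt ∉ D → f.1 γ = g.1 γ
  iseqv := ⟨fun _ _ _ => rfl, fun h γ hγ => (h γ hγ).symm,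
    fun h h' γ hγ => (h γ hγ).trans (h' γ hγ)⟩
  add' {f f' g g'} h h' γ hγ := by
    change f.1 γ + g.1 γ = f'.1 γ + g'.1 γ
    rw [h γ hγ, h' γ hγ]
  mul' {f f' g g'} h h' γ hγ := by
    refine finsum_congr fun p => ?_
    obtain ⟨⟨α, β⟩, hαβ, rfl⟩ := p
    dsimp only at hαβ ⊢
    -- If the range of β, which is the source of α, were in D, then by invariance so would be the
    -- range of α, which is that of γ.
    rw [h α hγ, h' β fun hβ => hγ (hD α (hαβ ▸ hβ))]

lemma finsum_ne_zero_iff (hS : ∀ a b : S, a + b = 0 → a = 0) {ι : Type*} {f : ι → S}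
    (hf : (Function.support f).Finite) : ∑ᶠ i, f i ≠ 0 ↔ ∃ i, f i ≠ 0 := by
  classical
  refine ⟨fun h => by contrapose! h; simp [h], ?_⟩
  rintro ⟨i, hi⟩ h
  rw [finsum_eq_sum f hf, ← Finset.add_sum_erase _ f (hf.mem_toFinset.2 hi)] at h
  exact hi (hS _ _ h)

/-- Without cancellation, the supports of the factors determine that of the product; this makes
`supportCon` multiplicative. -/
lemma conv_apply_ne_zero_iff [NoZeroDivisors S] (hS : ∀ a b : S, a + b = 0 → a = 0)
    {f : Arr X → S} (hf : f ∈ steinbergAlgebra S X) (g : Arr X → S) (γ : Arr X) :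
    conv f g γ ≠ 0 ↔ ∃ p : factorizations γ, f p.1.1 ≠ 0 ∧ g p.1.2 ≠ 0 := by
  simp only [conv, finsum_ne_zero_iff hS (finite_support_conv hf g γ), mul_ne_zero_iff]

variable (X) in
/-- Equality of supports, for coefficients without zero sums and zero divisors. -/
def supportCon [EtaleGroupoid X] [NoZeroDivisors S] (hS : ∀ a b : S, a + b = 0 → a = 0) :
    RingCon (steinbergAlgebra S X) where
  r f g := ∀ γ : Arr X, f.1 γ ≠ 0 ↔ g.1 γ ≠ 0
  iseqv := ⟨fun _ _ => Iff.rfl, fun h γ => (h γ).symm, fun h h' γ => (h γ).trans (h' γ)⟩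
  add' {f f' g g'} h h' γ := by
    have key : ∀ a b : S, a + b ≠ 0 ↔ a ≠ 0 ∨ b ≠ 0 := fun a b => by
      rw [← not_and_or, not_iff_not]
      exact ⟨fun e => ⟨hS a b e, hS b a (add_comm a b ▸ e)⟩, fun e => by simp [e.1, e.2]⟩
    change f.1 γ + g.1 γ ≠ 0 ↔ f'.1 γ + g'.1 γ ≠ 0
    rw [key, key, h γ, h' γ]
  mul' {f f' g g'} h h' γ := by
    change conv f.1 g.1 γ ≠ 0 ↔ conv f'.1 g'.1 γ ≠ 0
    rw [conv_apply_ne_zero_iff hS f.2, conv_apply_ne_zero_iff hS f'.2]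
    exact exists_congr fun p => and_congr (h _) (h' _)

end Congruences

/-! ### Consequences of congruence-simplicity. -/

section Simplicity

variable {S : Type w} {X : Type u} [Groupoid.{v} X] [TopologicalSpace X]
  [TopologicalSpace (Arr X)]

theorem isMinimalGroupoid_of_isCongruenceSimple [CommSemiring S] [Nontrivial S] [AmpleGroupoid X]
    (hsimple : IsCongruenceSimple (steinbergAlgebra S X)) : IsMinimalGroupoid X := by
  intro D hDo hD
  rcases hsimple (reductionCon S hD) with hdiag | hfull
  · left
    by_contra! hne
    obtain ⟨x, hx⟩ := hne
    obtain ⟨K, hK, hKo, hxK, hKD⟩ := exists_isCompact_isOpen_subset hDo hx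
    have hU := isCompactOpenBisection_image_unit hK hKo
    have h0 := hdiag ⟨chi S (unit '' K), chi_mem hU⟩ 0 fun γ hγ =>
      chi_apply_of_notMem (by rintro ⟨y, hy, rfl⟩; exact hγ (hKD hy))
    have h1 := congrFun (congrArg Subtype.val h0) (unit x)
    exact one_ne_zero ((chi_apply_of_mem (Set.mem_image_of_mem _ hxK)).symm.trans h1)
  · right
    refine Set.eq_univ_of_forall fun x => ?_
    by_contra hx
    obtain ⟨K, hK, hKo, hxK, -⟩ := exists_isCompact_isOpen_subset isOpen_univ (Set.mem_univ x)
    have hU := isCompactOpenBisection_image_unit hK hKo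
    have h1 := hfull ⟨chi S (unit '' K), chi_mem hU⟩ 0 (unit x) hx
    exact one_ne_zero ((chi_apply_of_mem (Set.mem_image_of_mem _ hxK)).symm.trans h1)

/-- A bisection of isotropy acts on functions on the unit space like its set of sources. -/
lemma chi_conv_comp_tgt_of_subset_iso [CommSemiring S] {U : Set (Arr X)} (hU : IsBisection U)
    (hiso : U ⊆ iso X) (φ : X → S) :
    conv (chi S U) (φ ∘ Arr.tgt) =
      conv (chi S (unit '' (Arr.src '' U))) (φ ∘ Arr.tgt) := by
  funext γ
  by_cases hγ : ∃ α ∈ U, α.tgt = γ.tgt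
  · obtain ⟨α, hα, ht⟩ := hγ
    have hs : α.src = γ.tgt := (hiso hα).trans ht
    have hK : γ.tgt ∈ Arr.src '' U := ⟨α, hα, hs⟩
    rw [chi_image_unit_conv_comp_tgt φ hK, chi_conv_comp_tgt hU.injOn_tgt φ hα ht, hs]
  · push Not at hγ
    rw [chi_conv_of_forall_tgt_ne _ hγ, chi_conv_of_forall_tgt_ne]
    rintro _ ⟨_, ⟨α, hα, rfl⟩, rfl⟩ e
    exact hγ α hα ((hiso hα).symm.trans e)

theorem isEffectiveGroupoid_of_isCongruenceSimple [CommSemiring S] [Nontrivial S]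
    [AmpleGroupoid X] (hsimple : IsCongruenceSimple (steinbergAlgebra S X)) :
    IsEffectiveGroupoid X := by
  refine (Set.Subset.antisymm ?_ range_unit_subset_interior_iso)
  intro γ hγ
  obtain ⟨U, hU, hγU, hUiso⟩ :=
    exists_isCompactOpenBisection_subset_iso isOpen_interior interior_subset hγ
  have hsU := isCompactOpenBisection_image_unit
    (hU.isCompact.image TopologicalGroupoid.continuous_src)
    (EtaleGroupoid.isLocalHomeomorph_src.isOpenMap _ hU.isOpen)
  rcases hsimple (actionCon S X) with hdiag | hfull
  · have h0 := hdiag ⟨chi S U, chi_mem hU⟩ ⟨_, chi_mem hsU⟩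
      (chi_conv_comp_tgt_of_subset_iso hU.isBisection (hUiso.trans interior_subset))
    have h1 := congrFun (congrArg Subtype.val h0) γ
    dsimp only at h1
    rw [chi_apply_of_mem hγU] at h1
    by_contra hne
    rw [chi_apply_of_notMem fun h => hne (Set.image_subset_range _ _ h)] at h1
    exact one_ne_zero h1
  -- The units s(U) fix the constant function 1 at the source of γ, whereas 0 kills it.
  · have h1 := congrFun (hfull ⟨_, chi_mem hsU⟩ 0 1) (unit γ.src)
    have h2 := chi_image_unit_conv_comp_tgt (1 : X → S) (γ := unit γ.src)
      (Set.mem_image_of_mem Arr.src hγU)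
    exact absurd (h2.symm.trans (h1.trans (congrFun (zero_conv _) _))) one_ne_zero

theorem eq_one_of_isCongruenceSimple [CommSemiring S] [Nontrivial S] [NoZeroDivisors S]
    [AmpleGroupoid X] [Nonempty X] (hS : ∀ a b : S, a + b = 0 → a = 0)
    (hsimple : IsCongruenceSimple (steinbergAlgebra S X)) {a : S} (ha : a ≠ 0) : a = 1 := by
  obtain ⟨x⟩ := ‹Nonempty X›
  obtain ⟨K, hK, hKo, hxK, -⟩ := exists_isCompact_isOpen_subset isOpen_univ (Set.mem_univ x)
  let f : steinbergAlgebra S X :=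
    ⟨chi S (unit '' K), chi_mem (isCompactOpenBisection_image_unit hK hKo)⟩
  have hfx : f.1 (unit x) = 1 := chi_apply_of_mem (Set.mem_image_of_mem _ hxK)
  rcases hsimple (supportCon X hS) with hdiag | hfull
  · have h0 : a • f = f := hdiag _ _ fun γ => by
      change a * f.1 γ ≠ 0 ↔ f.1 γ ≠ 0
      simp [ha]
    have h1 : a * f.1 (unit x) = f.1 (unit x) := congrFun (congrArg Subtype.val h0) (unit x)
    rwa [hfx, mul_one] at h1
  · exact absurd rfl ((hfull f 0 (unit x)).1 (by rw [hfx]; exact one_ne_zero))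

end Simplicity

/-! ### Recognizing fields and the Boolean semifield. -/

section Semifields

/-- A semifield in which `1` has an additive inverse is a field. -/
theorem exists_field_of_one_add_eq_zero {S : Type w} [inst : Semifield S] {b : S}
    (hb : 1 + b = 0) : ∃ F : Field S, F.toSemifield = inst := by
  let _ : Neg S := ⟨fun a => b * a⟩
  let F : Field S :=
    { inst with
      zsmul := zsmulRec
      neg_add_cancel := fun a => by
        change b * a + a = 0
        rw [← add_one_mul, add_comm, hb, zero_mul]
      qsmul := _
      qsmul_def := fun _ _ => rfl }
  -- The semifield structure was reused unchanged, so the equality is definitional.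
  exact ⟨F, rfl⟩

/-- A semifield whose only nonzero element is `1 = 1 + 1` is the Boolean semifield. -/
theorem nonempty_ringEquiv_booleanSemifield {S : Type w} [CommSemiring S] [Nontrivial S]
    (h : ∀ a : S, a ≠ 0 → a = 1) (h2 : (1 : S) + 1 = 1) :
    Nonempty (S ≃+* BooleanSemifield) := by
  let φ : BooleanSemifield → S
    | .zero => 0
    | .one => 1
  have hφ : Function.Bijective φ := by
    refine ⟨?_, fun a => ?_⟩
    · rintro (_ | _) (_ | _) e
      · rfl
      · exact absurd e zero_ne_one
      · exact absurd e one_ne_zero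
      · rfl
    · by_cases ha : a = 0
      · exact ⟨.zero, ha.symm⟩
      · exact ⟨.one, (h a ha).symm⟩
  refine ⟨(RingEquiv.mk (Equiv.ofBijective φ hφ) ?_ ?_).symm⟩
  · rintro (_ | _) b
    · exact (zero_mul (φ b)).symm
    · exact (one_mul (φ b)).symm
  · rintro (_ | _) b
    · exact (zero_add (φ b)).symm
    · cases b
      · exact (add_zero 1).symm
      · exact h2.symm

end Semifields

end Steinberg

theorem proposition3p2 {S : Type*} [Semifield S] {X : Type*} [CategoryTheory.Groupoid X]
    [TopologicalSpace X] [TopologicalSpace (Steinberg.Arr X)] [Steinberg.AmpleGroupoid X]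
    [Nonempty X]
    (hsimple : Steinberg.IsCongruenceSimple (Steinberg.steinbergAlgebra S X)) :
    ((∃ F : Field S, F.toSemifield = ‹Semifield S›) ∨
        Nonempty (S ≃+* Steinberg.BooleanSemifield)) ∧
      Steinberg.IsMinimalGroupoid X ∧ Steinberg.IsEffectiveGroupoid X := by
  refine ⟨?_, Steinberg.isMinimalGroupoid_of_isCongruenceSimple hsimple,
    Steinberg.isEffectiveGroupoid_of_isCongruenceSimple hsimple⟩
  by_cases hneg : ∃ b : S, 1 + b = 0
  · obtain ⟨b, hb⟩ := hneg
    exact .inl (Steinberg.exists_field_of_one_add_eq_zero hb)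
  · right
    have hS : ∀ a b : S, a + b = 0 → a = 0 := fun a b hab => by
      by_contra ha
      -- Dividing a + b = 0 by a would give a negative of 1.
      exact hneg ⟨a⁻¹ * b, by rw [← inv_mul_cancel₀ ha, ← mul_add, hab, mul_zero]⟩
    have hone : ∀ a : S, a ≠ 0 → a = 1 := fun a ha =>
      Steinberg.eq_one_of_isCongruenceSimple hS hsimple ha
    -- The absence of zero sums gives 1 + 1 ≠ 0, hence 1 + 1 = 1.
    exact Steinberg.nonempty_ringEquiv_booleanSemifield hone
      (hone _ fun h => one_ne_zero (hS 1 1 h))
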